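/- Let $S$ be a scheme, let $(\mathrm{Sch}/S)_{fppf}$ be the big fppf site of $S$, and for an $S$-scheme $U$ write $h_U$ for the functor it represents. An algebraic space over $S$ is an fppf sheaf of sets $F$ on $\mathrm{Sch}/S$ whose diagonal $F\to F\times F$ is representable by schemes and which admits a surjective étale map $h_U\to F$ from a scheme $U$ over $S$. A scheme $X$ is called perfect if, for some prime $p$, $p=0$ in $\mathcal O_X$ and the absolute Frobenius $X\to X$ (the identity on points, $g\mapsto g^p$ on $\mathcal O_X$) is an isomorphism. An algebraic space $F$ over $S$ is called - perfect if there is a surjective étale map $h_U\to F$ with $U$ a perfect scheme over $S$; - quasi-perfect if there are perfect schemes $U,V$ over $S$ such that for all $a\in F(U)$ and $b\in F(V)$ the functor $h_V\times_{b,F,a}h_U$ is represented by a perfect scheme over $S$. Let $\mathrm{Perf}_{AP_S}$ be the full subcategory of perfect algebraic spaces in the category of algebraic spaces over $S$. **Proposition.** Let $F\to H$ and $G\to H$ be morphisms of algebraic spaces over $S$, where $F$ and $G$ are perfect and $H$ is quasi-perfect. Suppose that there exist perfect schemes $U,V$ over $S$ and surjective étale maps $h_U\to F$ and $h_V\to G$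 such that $h_U\times_H h_V$ is represented by a perfect scheme over $S$. Then the fibre product $F\times_H G$ (formed as functors on $\mathrm{Sch}/S$) is a perfect algebraic space over $S$. If moreover $H$ is perfect, then $F\times_H G$, with its two projections, is a fibre product of $F\to H$ and $G\to H$ in the category $\mathrm{Perf}_{AP_S}$. -/

import Mathlib

universe u

open CategoryTheory Limits AlgebraicGeometry

namespace PerfectAlgSpace

/-- The Frobenius `a ↦ a ^ p` of a commutative ring in which the prime `p` is zero
(the zero ring is allowed). -/
def frobeniusHom (R : Type u) [CommRing R] (p : ℕ) (hp : p.Prime) (h : (p : R) = 0) :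
    R →+* R where
  toFun a := a ^ p
  map_one' := one_pow p
  map_mul' a b := mul_pow a b p
  map_zero' := zero_pow hp.ne_zero
  map_add' a b := by
    rcases subsingleton_or_nontrivial R with _ | _
    · exact Subsingleton.elim _ _
    · have : Fact p.Prime := ⟨hp⟩
      have : CharP R p := by
        rw [← CharP.ringChar_of_prime_eq_zero hp h]
        infer_instance
      exact add_pow_char a b p

/-- A scheme has characteristic `p` if `p` is zero in its structure sheaf. -/
def HasChar (p : ℕ) (X : Scheme.{u}) : Prop :=
  ∀ V : X.Opens, (p : Γ(X, V)) = 0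

/-- The morphism of ringed spaces `X ⟶ X` given by the identity on the underlying space
and by `g ↦ g ^ p` on the structure sheaf. -/
noncomputable def frobeniusPresheafed (p : ℕ) (hp : p.Prime) (X : Scheme.{u})
    (hX : HasChar p X) : X.toPresheafedSpace ⟶ X.toPresheafedSpace where
  base := 𝟙 _
  c :=
    { app := fun V => CommRingCat.ofHom
        (frobeniusHom (X.presheaf.obj V) p hp (hX V.unop))
      naturality := fun V W i => by
        ext a
        exact (map_pow (X.presheaf.map i).hom a p).symm }

theorem frobeniusPresheafed_stalkMap_apply (p : ℕ) (hp : p.Prime) (X : Scheme.{u})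
    (hX : HasChar p X) (x : X) (a : X.presheaf.stalk x) :
    ((frobeniusPresheafed p hp X hX).stalkMap x).hom a = a ^ p := by
  obtain ⟨V, hxV, s, rfl⟩ := TopCat.Presheaf.exists_germ_eq X.presheaf a
  refine (PresheafedSpace.stalkMap_germ_apply
    (frobeniusPresheafed p hp X hX) V x hxV s).trans ?_
  exact map_pow (X.presheaf.germ V x hxV).hom s p

/-- The absolute Frobenius `Φ_X : X ⟶ X` of a scheme of characteristic `p`. -/
noncomputable def absoluteFrobenius (p : ℕ) (hp : p.Prime) (X : Scheme.{u})
    (hX : HasChar p X) : X ⟶ X where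
  toHom := frobeniusPresheafed p hp X hX
  prop x := by
    constructor
    intro a ha
    have h := frobeniusPresheafed_stalkMap_apply p hp X hX x a
    rw [show ((frobeniusPresheafed p hp X hX).stalkMap x).hom a = a ^ p from h] at ha
    exact (isUnit_pow_iff hp.ne_zero).mp ha

/-- A scheme is perfect if it has characteristic `p` for some prime `p` and its absolute
Frobenius is an isomorphism. -/
def IsPerfectScheme (X : Scheme.{u}) : Prop :=
  ∃ (p : ℕ) (hp : p.Prime) (hX : HasChar p X), IsIso (absoluteFrobenius p hp X hX)

/-- The topology of the big fppf site `(Sch/S)_fppf`. -/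
noncomputable abbrev fppfOver (S : Scheme.{u}) : GrothendieckTopology (Over S) :=
  Scheme.fppfTopology.over S

/-- Functors `(Sch/S)ᵒᵖ ⥤ Sets`. -/
abbrev SetFunctor (S : Scheme.{u}) := (Over S)ᵒᵖ ⥤ Type u

/-- The functor `h_U` represented by an `S`-scheme `U`. -/
abbrev hFunctor {S : Scheme.{u}} (U : Over S) : SetFunctor S := yoneda.obj U

/-- Surjective étale morphisms of `S`-schemes. -/
def surjEtale (S : Scheme.{u}) : MorphismProperty (Over S) :=
  fun _ _ f => Surjective f.left ∧ Etale f.left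

/-- A map of functors `F ⟶ G` is surjective étale if it is representable and its base change
`F ×_G h_T ⟶ h_T` along every `h_T ⟶ G` is a surjective étale morphism of schemes. -/
def IsSurjEtale {S : Scheme.{u}} {F G : SetFunctor S} (f : F ⟶ G) : Prop :=
  (surjEtale S).presheaf f

/-- `F` is an algebraic space over `S`: an fppf sheaf with representable diagonal that admits
a surjective étale map from (the functor represented by) a scheme. -/
structure IsAlgebraicSpace {S : Scheme.{u}} (F : SetFunctor S) : Prop where
  isSheaf : Presheaf.IsSheaf (fppfOver S) F
  diag_representable : yoneda.relativelyRepresentable (diag F)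
  exists_atlas : ∃ (U : Over S) (a : hFunctor U ⟶ F), IsSurjEtale a

/-- The functor `F` is represented by a perfect scheme. -/
def IsRepresentedByPerfectScheme {S : Scheme.{u}} (F : SetFunctor S) : Prop :=
  ∃ W : Over S, IsPerfectScheme W.left ∧ Nonempty (hFunctor W ≅ F)

/-- Perfect algebraic spaces over `S`, as a property of functors `(Sch/S)ᵒᵖ ⥤ Sets`. -/
def IsPerfectAlgebraicSpace (S : Scheme.{u}) : ObjectProperty (SetFunctor S) :=
  fun F => IsAlgebraicSpace F ∧
    ∃ (U : Over S) (a : hFunctor U ⟶ F), IsPerfectScheme U.left ∧ IsSurjEtale a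

/-- Quasi-perfect algebraic spaces over `S`. By the Yoneda lemma, elements of `F(U)` are the
same as maps `h_U ⟶ F`. -/
def IsQuasiPerfectAlgebraicSpace (S : Scheme.{u}) : ObjectProperty (SetFunctor S) :=
  fun F => IsAlgebraicSpace F ∧
    ∃ U V : Over S, IsPerfectScheme U.left ∧ IsPerfectScheme V.left ∧
      ∀ (a : hFunctor U ⟶ F) (b : hFunctor V ⟶ F),
        IsRepresentedByPerfectScheme (pullback b a)

/-- The category `Perf_{AP_S}` of perfect algebraic spaces over `S`, a full subcategory of
the category of algebraic spaces, hence of that of functors `(Sch/S)ᵒᵖ ⥤ Sets`. -/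
abbrev PerfAP (S : Scheme.{u}) := (IsPerfectAlgebraicSpace S).FullSubcategory

end PerfectAlgSpace

/-! Every ingredient follows from stability under base change and composition. Writing P for the
fibre product of F and G over H, the map from `h_U ×_H h_V` to P is a base change of one atlas
followed by a base change of the other, hence surjective étale (`pullback_map_comp_mem`); its source
is a perfect scheme by assumption, so it is a perfect atlas. The diagonal of P is representable
because P embeds in `F ⨯ G` by a base change of the diagonal of H (`diag_pullback_mem`), and P is a
sheaf as a limit of sheaves. The universal property descends to the full subcategory. -/

namespace CategoryTheory.MorphismProperty

variable {C : Type*} [Category* C] (W : MorphismProperty C)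

attribute [local simp] prod.lift_fst prod.lift_snd prod.lift_fst_assoc prod.lift_snd_assoc
  pullback.lift_fst pullback.lift_snd pullback.lift_fst_assoc pullback.lift_snd_assoc

/-- Change one factor at a time, passing through `X ×_Z Y'`. -/
theorem pullback_map_comp_mem [HasPullbacks C] [W.IsStableUnderBaseChange]
    [W.IsStableUnderComposition] {X Y Z X' Y' : C} (f : X ⟶ Z) (g : Y ⟶ Z)
    (a : X' ⟶ X) (b : Y' ⟶ Y) (ha : W a) (hb : W b) :
    W (pullback.map (a ≫ f) (b ≫ g) f g a b (𝟙 Z) (by simp) (by simp)) := by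
  have h : pullback.map (a ≫ f) (b ≫ g) f g a b (𝟙 Z) (by simp) (by simp) =
      pullback.map (a ≫ f) (b ≫ g) f (b ≫ g) a (𝟙 _) (𝟙 Z) (by simp) (by simp) ≫
        pullback.map f (b ≫ g) f g (𝟙 _) b (𝟙 Z) (by simp) (by simp) := by
    ext <;> simp
  rw [h]
  refine W.comp_mem _ _ ?_ ?_
  -- Pasting law: the outer rectangle and the square over `f` are cartesian, so the square over `a`
  -- is too.
  · refine W.of_isPullback (f' := pullback.fst _ _) (f := pullback.fst _ _) (g := a) ?_ ha
    refine IsPullback.of_bot ?_ (by simp) (IsPullback.of_hasPullback f (b ≫ g))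
    simpa using IsPullback.of_hasPullback (a ≫ f) (b ≫ g)
  · refine W.of_isPullback (f' := pullback.snd _ _) (f := pullback.snd _ _) (g := b) ?_ hb
    refine IsPullback.of_bot ?_ (by simp) (IsPullback.of_hasPullback f g).flip
    simpa using (IsPullback.of_hasPullback f (b ≫ g)).flip

variable [HasBinaryProducts C]

theorem prod_map_id_mem [W.IsStableUnderBaseChange] {X Y Z : C} (p : X ⟶ Y) (hp : W p) :
    W (prod.map p (𝟙 Z)) :=
  W.of_isPullback (IsPullback.of_prod_fst_with_id p Z) hp

theorem prod_id_map_mem [W.IsStableUnderBaseChange] {X Y Z : C} (p : X ⟶ Y) (hp : W p) :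
    W (prod.map (𝟙 Z) p) := by
  refine W.of_isPullback (f' := prod.snd) (f := prod.snd) (g := p) ⟨⟨by simp⟩,
    ⟨PullbackCone.IsLimit.mk _ (fun s => prod.lift (s.snd ≫ prod.fst) s.fst) ?_ ?_ ?_⟩⟩ hp
  · intro s; simp
  · intro s; ext <;> simp [s.condition]
  · intro s m h1 h2; ext
    · simpa using h2 =≫ prod.fst
    · simpa using h1

/-- Up to exchanging the two middle factors, the diagonal of a product is the product of the
diagonals. -/
theorem diag_prod_mem [W.IsStableUnderBaseChange] [W.IsStableUnderComposition] {X Y : C}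
    (hX : W (diag X)) (hY : W (diag Y)) : W (diag (X ⨯ Y)) := by
  obtain ⟨e, he⟩ : ∃ e : (X ⨯ X) ⨯ (Y ⨯ Y) ≅ (X ⨯ Y) ⨯ (X ⨯ Y),
      e.hom = prod.lift (prod.map prod.fst prod.fst) (prod.map prod.snd prod.snd) :=
    ⟨{ hom := prod.lift (prod.map prod.fst prod.fst) (prod.map prod.snd prod.snd)
       inv := prod.lift (prod.map prod.fst prod.fst) (prod.map prod.snd prod.snd)
       hom_inv_id := by ext <;> simp
       inv_hom_id := by ext <;> simp }, rfl⟩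
  have h : diag (X ⨯ Y) =
      (prod.map (diag X) (𝟙 Y) ≫ prod.map (𝟙 (X ⨯ X)) (diag Y)) ≫ e.hom := by
    ext <;> simp [he, diag]
  rw [h]
  exact (W.cancel_right_of_respectsIso _ e.hom).mpr
    (W.comp_mem _ _ (W.prod_map_id_mem _ hX) (W.prod_id_map_mem _ hY))

variable [HasPullbacks C]

/-- This map is the base change of `diag Z` along `prod.map f g`. -/
theorem prod_lift_pullback_mem [W.IsStableUnderBaseChange] {X Y Z : C} (f : X ⟶ Z) (g : Y ⟶ Z)
    (hZ : W (diag Z)) : W (prod.lift (pullback.fst f g) (pullback.snd f g)) := by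
  refine W.of_isPullback (f' := pullback.fst f g ≫ f) (f := prod.map f g) (g := diag Z)
    ⟨⟨by ext <;> simp [pullback.condition, diag]⟩, ⟨PullbackCone.IsLimit.mk _
      (fun s => pullback.lift (s.snd ≫ prod.fst) (s.snd ≫ prod.snd) ?_) ?_ ?_ ?_⟩⟩ hZ
  · have h1 := s.condition =≫ prod.fst
    have h2 := s.condition =≫ prod.snd
    simp only [Category.assoc, diag, prod.lift_fst, prod.lift_snd, prod.map_fst, prod.map_snd,
      Category.comp_id] at h1 h2 ⊢
    rw [← h1, ← h2]
  · intro s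
    have h1 := s.condition =≫ prod.fst
    simpa [diag] using h1.symm
  · intro s; ext <;> simp
  · intro s m _ h2
    ext
    · simpa using h2 =≫ prod.fst
    · simpa using h2 =≫ prod.snd

/-- With `i` the embedding into `X ⨯ Y`, naturality of the diagonal puts its composite with `i ⨯ i`
in `W`; that monomorphism can then be cancelled. -/
theorem diag_pullback_mem [W.IsStableUnderBaseChange] [W.IsStableUnderComposition] {X Y Z : C}
    (f : X ⟶ Z) (g : Y ⟶ Z) (hX : W (diag X)) (hY : W (diag Y)) (hZ : W (diag Z)) :
    W (diag (pullback f g)) := by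
  let i := prod.lift (pullback.fst f g) (pullback.snd f g)
  have : Mono i := ⟨fun a b h => by
    ext
    · simpa [i, -prod.comp_lift] using h =≫ prod.fst
    · simpa [i, -prod.comp_lift] using h =≫ prod.snd⟩
  have h : W (diag (pullback f g) ≫ prod.map i i) := by
    rw [show diag (pullback f g) ≫ prod.map i i = i ≫ diag (X ⨯ Y) by
      ext <;> simp [diag, -prod.comp_lift]]
    exact W.comp_mem _ _ (W.prod_lift_pullback_mem f g hZ) (W.diag_prod_mem hX hY)
  -- Since `prod.map i i` is mono, pulling the composite back along it returns the diagonal itself.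
  refine W.of_isPullback (f' := 𝟙 _) (f := prod.map i i) ⟨⟨by simp⟩,
    ⟨PullbackCone.IsLimit.mk _ (fun s => s.fst) ?_ ?_ ?_⟩⟩ h
  · intro s; simp
  · intro s; rw [← cancel_mono (prod.map i i), Category.assoc, s.condition]
  · intro s m h1 _; simpa using h1

end CategoryTheory.MorphismProperty

namespace PerfectAlgSpace

instance surjEtale_isStableUnderBaseChange (S : Scheme.{u}) :
    (surjEtale S).IsStableUnderBaseChange where
  of_isPullback {_ _ _ _ f g f' g'} h hg := by
    have h' := h.map (Over.forget S)
    exact ⟨MorphismProperty.of_isPullback (P := @Surjective) h' hg.1,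
      MorphismProperty.of_isPullback (P := @Etale) h' hg.2⟩

instance surjEtale_isStableUnderComposition (S : Scheme.{u}) :
    (surjEtale S).IsStableUnderComposition where
  comp_mem f g hf hg :=
    have := hf.1
    have := hg.1
    have := hf.2
    have := hg.2
    ⟨inferInstanceAs (Surjective (f.left ≫ g.left)), inferInstanceAs (Etale (f.left ≫ g.left))⟩

instance surjEtale_presheaf_isStableUnderBaseChange (S : Scheme.{u}) :
    (surjEtale S).presheaf.IsStableUnderBaseChange :=
  MorphismProperty.relative_isStableUnderBaseChange _

/-- The fibre product of two algebraic spaces over a third is an algebraic space as soon as it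
has an atlas. -/
theorem isAlgebraicSpace_pullback {S : Scheme.{u}} {F G H : SetFunctor S} (f : F ⟶ H) (g : G ⟶ H)
    (hF : IsAlgebraicSpace F) (hG : IsAlgebraicSpace G) (hH : IsAlgebraicSpace H)
    (h : ∃ (U : Over S) (a : hFunctor U ⟶ pullback f g), IsSurjEtale a) :
    IsAlgebraicSpace (pullback f g) where
  isSheaf := by
    -- Sheaves are closed under limits of presheaves; the cases are the vertex and the two feet of
    -- the cospan.
    refine ObjectProperty.prop_limit (P := Presheaf.IsSheaf (fppfOver S)) _ ?_
    rintro (_ | _ | _)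
    exacts [hH.isSheaf, hF.isSheaf, hG.isSheaf]
  diag_representable := MorphismProperty.diag_pullback_mem _ f g
    hF.diag_representable hG.diag_representable hH.diag_representable
  exists_atlas := h

/-- If `F` and `G` have atlases whose fibre product over `H` is represented by a perfect scheme,
then the fibre product of `F` and `G` over `H` has an atlas by a perfect scheme. -/
theorem exists_perfect_atlas_pullback {S : Scheme.{u}} {F G H : SetFunctor S}
    (f : F ⟶ H) (g : G ⟶ H) {U V : Over S} (a : hFunctor U ⟶ F) (b : hFunctor V ⟶ G)
    (ha : IsSurjEtale a) (hb : IsSurjEtale b)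
    (h : IsRepresentedByPerfectScheme (pullback (a ≫ f) (b ≫ g))) :
    ∃ (W : Over S) (c : hFunctor W ⟶ pullback f g),
      IsPerfectScheme W.left ∧ IsSurjEtale c := by
  obtain ⟨W, hW, ⟨e⟩⟩ := h
  exact ⟨W, e.hom ≫ pullback.map _ _ f g a b (𝟙 H) (by simp) (by simp), hW,
    ((surjEtale S).presheaf.cancel_left_of_respectsIso _ _).mpr
      (MorphismProperty.pullback_map_comp_mem _ f g a b ha hb)⟩

end PerfectAlgSpace

theorem mainTheorem4 (S : Scheme.{u}) (F G H : PerfectAlgSpace.SetFunctor S)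
    (f : F ⟶ H) (g : G ⟶ H)
    (hF : PerfectAlgSpace.IsPerfectAlgebraicSpace S F)
    (hG : PerfectAlgSpace.IsPerfectAlgebraicSpace S G)
    (hH : PerfectAlgSpace.IsQuasiPerfectAlgebraicSpace S H)
    (hUV : ∃ (U V : Over S) (a : PerfectAlgSpace.hFunctor U ⟶ F)
      (b : PerfectAlgSpace.hFunctor V ⟶ G),
      PerfectAlgSpace.IsPerfectScheme U.left ∧ PerfectAlgSpace.IsPerfectScheme V.left ∧
      PerfectAlgSpace.IsSurjEtale a ∧ PerfectAlgSpace.IsSurjEtale b ∧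
      PerfectAlgSpace.IsRepresentedByPerfectScheme (pullback (a ≫ f) (b ≫ g))) :
    ∃ hP : PerfectAlgSpace.IsPerfectAlgebraicSpace S (pullback f g),
      ∀ hH' : PerfectAlgSpace.IsPerfectAlgebraicSpace S H,
        IsPullback (C := PerfectAlgSpace.PerfAP S)
          (ObjectProperty.homMk (pullback.fst f g) : ⟨pullback f g, hP⟩ ⟶ ⟨F, hF⟩)
          (ObjectProperty.homMk (pullback.snd f g) : ⟨pullback f g, hP⟩ ⟶ ⟨G, hG⟩)
          (ObjectProperty.homMk f : ⟨F, hF⟩ ⟶ ⟨H, hH'⟩)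
          (ObjectProperty.homMk g : ⟨G, hG⟩ ⟶ ⟨H, hH'⟩) := by
  obtain ⟨U, V, a, b, -, -, ha, hb, hab⟩ := hUV
  have h := PerfectAlgSpace.exists_perfect_atlas_pullback f g a b ha hb hab
  have hP : PerfectAlgSpace.IsPerfectAlgebraicSpace S (pullback f g) :=
    ⟨PerfectAlgSpace.isAlgebraicSpace_pullback f g hF.1 hG.1 hH.1
      (h.imp fun _ ↦ Exists.imp fun _ ↦ And.right), h⟩
  -- The inclusion `ι` is fully faithful, so it reflects the cartesian square of functors.
  exact ⟨hP, fun _ ↦ IsPullback.of_map_of_faithful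
    (PerfectAlgSpace.IsPerfectAlgebraicSpace S).ι (IsPullback.of_hasPullback f g)⟩
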